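/- Let $C$ be a commutative Noetherian ring of finite Krull dimension $\dim C = D$, let $n \ge 0$, and let $A = C[x_1,\dots,x_n]$. Let $r \ge \max(3, D+2)$. Index the coordinates of $A^{2r}$ by $1,\dots,r,-r,\dots,-1$ and those of $A^{2r+1}$ by $1,\dots,r,0,-r,\dots,-1$, and put $q(x)=\sum_{i=1}^r x_i x_{-i}$ on $A^{2r}$ and $q(x)=x_0^2+\sum_{i=1}^r x_i x_{-i}$ on $A^{2r+1}$. A column is called unimodular if its entries generate the unit ideal. Let $$\mathrm{IUm}_{2r}A=\{b\in A^{2r} : b \text{ is unimodular},\ q(b)=0\},$$ $$\mathrm{IUm}_{2r+1}A=\{b\in A^{2r+1} : (b_1,\dots,b_r,2b_0,b_{-r},\dots,b_{-1}) \text{ is unimodular},\ q(b)=0\}.$$ Let $e$ be the identity matrix and $e_{i,j}$ the matrix units. The elementary orthogonal transvections of size $2r$ are the matrices $T_{i,j}(\xi)=e+\xi e_{i,j}-\xi e_{-j,-i}$ with $\xi\in A$ and $i,j\in\{\pm1,\dots,\pm r\}$, $i\ne\pm j$. Those of size $2r+1$ are the matrices $T_{i,j}(\xi)$ given by the same formula,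 for the same $i,j$ and $\xi$, together with the matrices $T_{i,0}(\xi)=e+2\xi e_{i,0}-\xi e_{0,-i}-\xi^2 e_{i,-i}$ with $\xi\in A$ and $i\in\{\pm1,\dots,\pm r\}$. For $m=2r$ or $m=2r+1$ let $EO(m,A)^{\le N}$ be the set of all products of at most $N$ elementary orthogonal transvections of size $m$. Order the monomials lexicographically: $x_1^{k_1}\cdots x_n^{k_n}$ is bigger than $x_1^{l_1}\cdots x_n^{l_n}$ if for some $m$ we have $k_i=l_i$ for $i<m$ and $k_m>l_m$. A polynomial in $A$ is called lexicographically monic if its leading coefficient with respect to this order is $1$. Then for every $b\in\mathrm{IUm}_{2r}A$ there is a column $b'\in EO(2r,A)^{\le 11r-7}\,b$ whose entry $b'_{-2}$ is lexicographically monic, and for every $b\in\mathrm{IUm}_{2r+1}A$ there is a column $b'\in EO(2r+1,A)^{\le 12r-8}\,b$ whose entry $b'_{-2}$ is lexicographically monic. -/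

import Mathlib

open scoped Matrix

namespace SplitOrthogonal

/-- The indices `1, …, r, -r, …, -1` of the even split orthogonal group of rank `2r`:
`Sum.inl i` is the positive index `i + 1` and `Sum.inr i` is the negative index `-(i + 1)`. -/
abbrev EvenIdx (r : ℕ) : Type := Fin r ⊕ Fin r

/-- The indices `1, …, r, 0, -r, …, -1` of the odd split orthogonal group of rank `2r + 1`:
`none` is the index `0` and `some i` is the nonzero index `i`. -/
abbrev OddIdx (r : ℕ) : Type := Option (EvenIdx r)

/-- The index `-i`. -/
abbrev negIdx {r : ℕ} (i : EvenIdx r) : EvenIdx r := i.swap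

/-- The negative index `-k`, for `1 ≤ k ≤ r`. -/
def minus {r : ℕ} (k : ℕ) (hk : 1 ≤ k ∧ k ≤ r) : EvenIdx r :=
  Sum.inr ⟨k - 1, by omega⟩

/-- A column is unimodular if its entries generate the unit ideal. -/
def IsUnimodular {ι R : Type*} [CommRing R] (b : ι → R) : Prop :=
  Ideal.span (Set.range b) = ⊤

section Even

variable {R : Type*} [CommRing R]

/-- The even split quadratic form `∑ i, x_i x_{-i}` on `R ^ (2r)`. -/
def evenForm {r : ℕ} (x : EvenIdx r → R) : R :=
  ∑ i : Fin r, x (Sum.inl i) * x (Sum.inr i)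

/-- The matrix `T_{i,j}(ξ) = e + ξ e_{i,j} - ξ e_{-j,-i}` of size `2r`. -/
def evenT {r : ℕ} (i j : EvenIdx r) (ξ : R) : Matrix (EvenIdx r) (EvenIdx r) R :=
  1 + Matrix.single i j ξ - Matrix.single (negIdx j) (negIdx i) ξ

/-- Elementary orthogonal transvections of size `2r`: the `T_{i,j}(ξ)` with `i ≠ ±j`. -/
def IsEvenTransvection {r : ℕ} (g : Matrix (EvenIdx r) (EvenIdx r) R) : Prop :=
  ∃ (i j : EvenIdx r) (ξ : R), i ≠ j ∧ i ≠ negIdx j ∧ g = evenT i j ξ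

variable (R) in
/-- `EO(2r, R)^{≤ N}`: products of at most `N` elementary orthogonal transvections. -/
def evenEOLe (r N : ℕ) : Set (Matrix (EvenIdx r) (EvenIdx r) R) :=
  {g | ∃ l : List (Matrix (EvenIdx r) (EvenIdx r) R),
    l.length ≤ N ∧ (∀ t ∈ l, IsEvenTransvection t) ∧ g = l.prod}

variable (R) in
/-- The isotropic unimodular columns of height `2r`. -/
def evenIUm (r : ℕ) : Set (EvenIdx r → R) :=
  {b | IsUnimodular b ∧ evenForm b = 0}

end Even

section Odd

variable {R : Type*} [CommRing R]

/-- The odd split quadratic form `x_0 ^ 2 + ∑ i, x_i x_{-i}` on `R ^ (2r + 1)`. -/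
def oddForm {r : ℕ} (x : OddIdx r → R) : R :=
  x none ^ 2 + ∑ i : Fin r, x (some (Sum.inl i)) * x (some (Sum.inr i))

/-- The matrix `T_{i,j}(ξ) = e + ξ e_{i,j} - ξ e_{-j,-i}` of size `2r + 1`. -/
def oddLongT {r : ℕ} (i j : EvenIdx r) (ξ : R) : Matrix (OddIdx r) (OddIdx r) R :=
  1 + Matrix.single (some i) (some j) ξ - Matrix.single (some (negIdx j)) (some (negIdx i)) ξ

/-- The matrix `T_{i,0}(ξ) = e + 2ξ e_{i,0} - ξ e_{0,-i} - ξ² e_{i,-i}` of size `2r + 1`. -/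
def oddShortT {r : ℕ} (i : EvenIdx r) (ξ : R) : Matrix (OddIdx r) (OddIdx r) R :=
  1 + Matrix.single (some i) none (2 * ξ) - Matrix.single none (some (negIdx i)) ξ
    - Matrix.single (some i) (some (negIdx i)) (ξ ^ 2)

/-- Elementary orthogonal transvections of size `2r + 1`: the long root transvections `T_{i,j}(ξ)`
with `i ≠ ±j`, and the short root transvections `T_{i,0}(ξ)`. -/
def IsOddTransvection {r : ℕ} (g : Matrix (OddIdx r) (OddIdx r) R) : Prop :=
  (∃ (i j : EvenIdx r) (ξ : R), i ≠ j ∧ i ≠ negIdx j ∧ g = oddLongT i j ξ) ∨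
    ∃ (i : EvenIdx r) (ξ : R), g = oddShortT i ξ

variable (R) in
/-- `EO(2r + 1, R)^{≤ N}`: products of at most `N` elementary orthogonal transvections. -/
def oddEOLe (r N : ℕ) : Set (Matrix (OddIdx r) (OddIdx r) R) :=
  {g | ∃ l : List (Matrix (OddIdx r) (OddIdx r) R),
    l.length ≤ N ∧ (∀ t ∈ l, IsOddTransvection t) ∧ g = l.prod}

/-- The column `b` with its middle entry `b_0` replaced by `2 b_0`. -/
def doubleMiddle {r : ℕ} (b : OddIdx r → R) : OddIdx r → R
  | none => 2 * b none
  | some i => b (some i)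

variable (R) in
/-- The columns `b` of height `2r + 1` that are isotropic and stay unimodular
when `b_0` is replaced by `2 b_0`. -/
def oddIUm (r : ℕ) : Set (OddIdx r → R) :=
  {b | IsUnimodular (doubleMiddle b) ∧ oddForm b = 0}

end Odd

/-- A polynomial in `x_1, …, x_n` (the variables `X 0, …, X (n - 1)`) is lexicographically monic if
its leading coefficient, for the lexicographic order with `x_1 > x_2 > … > x_n`, is one. -/
def IsLexMonic {C : Type*} [CommRing C] {n : ℕ} (f : MvPolynomial (Fin n) C) : Prop :=
  (MonomialOrder.lex (σ := Fin n)).Monic f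

end SplitOrthogonal

/-! ### Heights of primes in `R[X]` and leading coefficients. -/

section Heights

open Polynomial

/-! Write the column as `(u, v)` and let `k` be the index 2. If no prime of height at most `D`
contains all `u i`, `i ≠ k`, then these entries generate an ideal containing a lexicographically
monic `f`: passing to leading coefficients in one variable after another keeps every prime over the
ideal of height above `D`, and `C` has no such primes, so the ideal ends as the unit ideal
(`exists_isLexMonic_mem`). A further `r - 1` transvections add any element of the ideal to `v k`,
and a large monomial multiple of `f` dominates `v k`.

To reach this position, note that adding multiples of `s` to the `r - 1 > D` entries `u i` forces
every prime of height at most `D` over them to contain `s` (`exists_add_mul_general_position`).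
Three rounds, with `s` equal to `v k`, `u k * u k` and the new `v k`, remove these primes; the
middle round uses a unimodularity relation. The total is `4 * (r - 1)`. In odd size, isotropy makes
the column without its middle entry unimodular, and long root transvections act on it as in even
size. -/

theorem Ideal.height_le_one_of_comap_C_eq_bot {R : Type*} [CommRing R] [IsDomain R]
    (P : Ideal R[X]) [P.IsPrime] (hP : P.comap C = ⊥) : P.height ≤ 1 := by
  let := Polynomial.algebra R (FractionRing R)
  have := Polynomial.isLocalization (nonZeroDivisors R) (FractionRing R)
  have hdisj : Disjoint (((nonZeroDivisors R).map C : Submonoid R[X]) : Set R[X])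
      (P : Set R[X]) := by
    rw [Set.disjoint_left]
    rintro _ ⟨a, ha, rfl⟩ haP
    have : a ∈ P.comap C := haP
    rw [hP, Ideal.mem_bot] at this
    exact nonZeroDivisors.ne_zero ha this
  -- Inverting the nonzero constants keeps the height of `P` and leads to `K[X]`, of dimension one.
  rw [← IsLocalization.height_map_of_disjoint (S := (FractionRing R)[X])
    ((nonZeroDivisors R).map C) P hdisj]
  have := IsLocalization.isPrime_of_isPrime_disjoint ((nonZeroDivisors R).map C)
    (FractionRing R)[X] P ‹_› hdisj
  have h := Ideal.height_le_ringKrullDim_of_isPrime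
    (I := P.map (algebraMap R[X] (FractionRing R)[X]))
  rw [Polynomial.ringKrullDim_of_isNoetherianRing, ringKrullDim_eq_zero_of_field, zero_add] at h
  exact_mod_cast h

variable {R : Type*} [CommRing R] [IsNoetherianRing R]

/-- The height of `P` is at most that of `p` plus that of `P / p R[X]`, a prime of `(R ⧸ p)[X]`
contracting to zero. -/
theorem Ideal.height_le_height_comap_C_add_one (P : Ideal R[X]) [P.IsPrime] :
    P.height ≤ (P.comap C).height + 1 := by
  set p := P.comap C
  have : p.IsPrime := Ideal.comap_isPrime C P
  have : P.LiesOver p := ⟨rfl⟩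
  refine (Ideal.height_le_height_add_of_liesOver p P).trans ?_
  gcongr
  let e : (R[X] ⧸ (p.map (algebraMap R R[X]))) ≃+* (R ⧸ p)[X] :=
    (polynomialQuotientEquivQuotientPolynomial p).symm
  rw [← e.height_map]
  have hle : p.map (algebraMap R R[X]) ≤ P := Ideal.map_le_iff_le_comap.2 le_rfl
  have : (P.map (Ideal.Quotient.mk (p.map (algebraMap R R[X])))).IsPrime :=
    Ideal.map_isPrime_of_surjective Ideal.Quotient.mk_surjective (by rwa [Ideal.mk_ker])
  have : (Ideal.map e (P.map (Ideal.Quotient.mk (p.map (algebraMap R R[X]))))).IsPrime :=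
    Ideal.map_isPrime_of_equiv e
  apply Ideal.height_le_one_of_comap_C_eq_bot
  rw [eq_bot_iff]
  intro a ha
  obtain ⟨a, rfl⟩ := Ideal.Quotient.mk_surjective a
  rw [Ideal.mem_comap, Ideal.mem_map_of_equiv] at ha
  obtain ⟨x, hx, hxe⟩ := ha
  have hCa : e (Ideal.Quotient.mk _ (C a)) = C (Ideal.Quotient.mk p a) := by
    have := Ideal.polynomialQuotientEquivQuotientPolynomial_symm_mk p (C a)
    rwa [Polynomial.map_C] at this
  rw [← hCa] at hxe
  rw [e.injective hxe, Ideal.mem_quotient_iff_mem hle] at hx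
  rw [Ideal.mem_bot, Ideal.Quotient.eq_zero_iff_mem]
  exact hx

theorem Ideal.height_map_C_le (p : Ideal R) [p.IsPrime] :
    (p.map (C : R →+* R[X])).height ≤ p.height := by
  have : (p.map (C : R →+* R[X])).IsPrime := inferInstance
  have : (p.map (C : R →+* R[X])).LiesOver p := ⟨by
    ext a
    simp [Ideal.mem_comap, Ideal.mem_map_C_iff, Polynomial.coeff_C, Ideal.under]
    refine ⟨fun h n => ?_, fun h => by simpa using h 0⟩
    split_ifs <;> simp [h]⟩
  have : (p.map (algebraMap R R[X])).IsPrime := ‹(p.map (C : R →+* R[X])).IsPrime›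
  have : (p.map (algebraMap R R[X])).LiesOver p := ‹(p.map (C : R →+* R[X])).LiesOver p›
  have : IsDomain (R[X] ⧸ p.map (algebraMap R R[X])) := Ideal.Quotient.isDomain _
  refine (Ideal.height_le_height_add_of_liesOver p (p.map (algebraMap R R[X]))).trans ?_
  simp

/-- If a prime of `R` contains all leading coefficients of a prime `P` of `R[X]`, then its height
is at least the height of `P`. -/
theorem Ideal.height_le_of_leadingCoeff_le (P : Ideal R[X]) [P.IsPrime] (Q : Ideal R) [Q.IsPrime]
    (h : P.leadingCoeff ≤ Q) : P.height ≤ Q.height := by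
  have : (P.comap C).IsPrime := Ideal.comap_isPrime C P
  have hpL : P.comap C ≤ P.leadingCoeff := fun a ha =>
    (P.mem_leadingCoeff a).2 ⟨C a, ha, leadingCoeff_C a⟩
  have hmap : (P.comap C).map C ≤ P := Ideal.map_le_iff_le_comap.2 le_rfl
  by_cases hL : P.leadingCoeff ≤ P.comap C
  -- Leading terms can be stripped off one by one, so `P` is extended from its contraction.
  · have : P ≤ (P.comap C).map C := by
      intro f
      induction hn : f.natDegree using Nat.strong_induction_on generalizing f with
      | _ n ih =>
        intro hf
        have hlc : C f.leadingCoeff ∈ P := hL ((P.mem_leadingCoeff _).2 ⟨f, hf, rfl⟩)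
        have hlm : C f.leadingCoeff * X ^ f.natDegree ∈ (P.comap C).map C :=
          Ideal.mul_mem_right _ _ (Ideal.mem_map_of_mem C hlc)
        rw [← f.eraseLead_add_C_mul_X_pow]
        refine add_mem ?_ hlm
        rcases Nat.eq_zero_or_pos n with h0 | hpos
        · have : f.eraseLead = 0 := by
            rw [eq_C_of_natDegree_eq_zero (hn.trans h0)]
            exact eraseLead_C _
          simp [this]
        · refine ih f.eraseLead.natDegree ?_ rfl ?_
          · have := f.eraseLead_natDegree_le
            omega
          · rw [← self_sub_C_mul_X_pow]
            exact sub_mem hf (hmap hlm)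
    calc P.height ≤ ((P.comap C).map C).height := Ideal.height_mono this
      _ ≤ (P.comap C).height := Ideal.height_map_C_le _
      _ ≤ Q.height := Ideal.height_mono (hpL.trans h)
  -- Strictness of this inclusion pays for the 1 lost on contraction.
  · have hlt : P.comap C < Q := lt_of_le_of_ne (hpL.trans h) fun he => hL (he ▸ h)
    exact (Ideal.height_le_height_comap_C_add_one P).trans
      (Ideal.height_add_one_le_of_lt_of_isPrime hlt)

/-- A prime containing the leading coefficients of an ideal `I` contains the leading coefficients
of some prime over `I`. -/
theorem Ideal.exists_isPrime_leadingCoeff_le {R : Type*} [CommRing R] (I : Ideal R[X]) (Q : Ideal R)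
    [hQ : Q.IsPrime] (h : I.leadingCoeff ≤ Q) :
    ∃ P : Ideal R[X], P.IsPrime ∧ I ≤ P ∧ P.leadingCoeff ≤ Q := by
  -- A product of leading coefficients outside `Q` is outside `Q`, hence nonzero, hence the leading
  -- coefficient of the product.
  let S : Submonoid R[X] :=
    { carrier := {f | f.leadingCoeff ∉ Q}
      one_mem' := by
        have : Nontrivial R := nontrivial_of_ne 1 0 fun h1 => by
          exact hQ.ne_top ((Ideal.eq_top_iff_one Q).2 (h1 ▸ Q.zero_mem))
        simpa using fun h1 => hQ.ne_top ((Ideal.eq_top_iff_one Q).2 h1)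
      mul_mem' := by
        intro f g hf hg
        have hfg : f.leadingCoeff * g.leadingCoeff ∉ Q := fun hm =>
          (hQ.mem_or_mem hm).elim hf hg
        have : (f * g).leadingCoeff = f.leadingCoeff * g.leadingCoeff :=
          leadingCoeff_mul' fun h0 => hfg (h0 ▸ Q.zero_mem)
        simpa [this] using hfg }
  have hdisj : Disjoint (I : Set R[X]) S := by
    rw [Set.disjoint_left]
    exact fun f hf hfS => hfS (h ((I.mem_leadingCoeff _).2 ⟨f, hf, rfl⟩))
  obtain ⟨P, hP, hIP, hPS⟩ := Ideal.exists_le_prime_disjoint I S hdisj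
  refine ⟨P, hP, hIP, fun a ha => ?_⟩
  obtain ⟨f, hf, rfl⟩ := (P.mem_leadingCoeff a).1 ha
  by_contra hfQ
  exact Set.disjoint_left.1 hPS hf hfQ

end Heights

/-! ### Lexicographically monic polynomials in ideals. -/

section LexMonic

open MvPolynomial SplitOrthogonal
open scoped MonomialOrder

theorem MonomialOrder.monic_of_forall_le {σ C : Type*} [CommRing C] (m : MonomialOrder σ)
    {f : MvPolynomial σ C} {e : σ →₀ ℕ} (he : f.coeff e = 1)
    (hle : ∀ c ∈ f.support, c ≼[m] e) : m.Monic f := by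
  nontriviality C
  have h1 : m.degree f ≼[m] e := m.degree_le_iff.2 hle
  have h2 : e ≼[m] m.degree f := m.le_degree (by simp [he])
  have : m.degree f = e := m.toSyn.injective (le_antisymm h1 h2)
  rw [MonomialOrder.Monic, MonomialOrder.leadingCoeff, this, he]

/-- The order compares exponents of the first variable, then breaks ties in the remaining ones. -/
theorem isLexMonic_of_leadingCoeff_finSuccEquiv {C : Type*} [CommRing C] {n : ℕ}
    {f : MvPolynomial (Fin (n + 1)) C}
    (hf : IsLexMonic (finSuccEquiv C n f).leadingCoeff) : IsLexMonic f := by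
  refine MonomialOrder.lex.monic_of_forall_le
    (e := (MonomialOrder.lex.degree (finSuccEquiv C n f).leadingCoeff).cons
      (finSuccEquiv C n f).natDegree) ?_ ?_
  · rw [← finSuccEquiv_coeff_coeff]
    exact hf
  · intro c hc
    rw [← Finsupp.cons_tail c] at hc ⊢
    rw [mem_support_iff, ← finSuccEquiv_coeff_coeff] at hc
    have hdeg : c 0 ≤ (finSuccEquiv C n f).natDegree :=
      Polynomial.le_natDegree_of_ne_zero fun h => hc (by simp [h])
    rw [MonomialOrder.lex_le_iff]
    rcases hdeg.lt_or_eq with hlt | heq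
    · refine le_of_lt (Finsupp.Lex.lt_iff.2 ⟨0, fun j hj => absurd hj (Fin.not_lt_zero j), ?_⟩)
      simpa using hlt
    · have hle := MonomialOrder.lex.le_degree (f := (finSuccEquiv C n f).leadingCoeff)
        (d := c.tail) (by rw [mem_support_iff, Polynomial.leadingCoeff, ← heq]; exact hc)
      rw [MonomialOrder.lex_le_iff] at hle
      rcases hle.lt_or_eq with hlt | heq'
      · obtain ⟨i, hi, hi'⟩ := Finsupp.Lex.lt_iff.1 hlt
        refine le_of_lt (Finsupp.Lex.lt_iff.2 ⟨i.succ, fun j hj => ?_, ?_⟩)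
        · induction j using Fin.cases with
          | zero => simpa using heq
          | succ j => simpa [Finsupp.tail_apply] using hi j (by simpa using hj)
        · simpa [Finsupp.tail_apply] using hi'
      · have : c.tail = MonomialOrder.lex.degree (finSuccEquiv C n f).leadingCoeff := heq'
        rw [this, heq]

/-- An ideal of `C[x_1, …, x_n]` all of whose primes have height larger than the dimension of `C`
contains a lexicographically monic polynomial. -/
theorem exists_isLexMonic_mem {C : Type*} [CommRing C] [IsNoetherianRing C] {D : ℕ}
    (hD : ringKrullDim C ≤ (D : WithBot ℕ∞)) {n : ℕ} (I : Ideal (MvPolynomial (Fin n) C))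
    (hI : ∀ P : Ideal (MvPolynomial (Fin n) C), P.IsPrime → I ≤ P → ¬ P.height ≤ D) :
    ∃ f ∈ I, IsLexMonic f := by
  induction n with
  | zero =>
    have hItop : I = ⊤ := by
      by_contra hne
      obtain ⟨P, hP, hIP⟩ := Ideal.exists_le_maximal I hne
      have h1 := Ideal.height_le_ringKrullDim_of_isPrime (I := P)
      rw [ringKrullDim_eq_of_ringEquiv (isEmptyRingEquiv C (Fin 0))] at h1
      exact hI P hP.isPrime hIP (by exact_mod_cast h1.trans hD)
    exact ⟨1, hItop ▸ Submodule.mem_top, MonomialOrder.monic_one⟩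
  | succ n ih =>
    let e := (finSuccEquiv C n).toRingEquiv
    obtain ⟨g, hg, hgm⟩ := ih (I.map e).leadingCoeff fun Q hQ hQI hQD => by
      obtain ⟨P, hP, hIP, hPQ⟩ := (I.map e).exists_isPrime_leadingCoeff_le Q hQI
      have := Ideal.height_le_of_leadingCoeff_le P Q hPQ
      refine hI (P.comap e) (Ideal.comap_isPrime e P) (Ideal.map_le_iff_le_comap.1 hIP) ?_
      rw [e.height_comap]
      exact this.trans hQD
    obtain ⟨q, hq, rfl⟩ := (Ideal.mem_leadingCoeff _ _).1 hg
    obtain ⟨f, hf, rfl⟩ := (Ideal.mem_map_of_equiv e q).1 hq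
    exact ⟨f, hf, isLexMonic_of_leadingCoeff_finSuccEquiv hgm⟩

theorem exists_add_isLexMonic {C : Type*} [CommRing C] {n : ℕ} {I : Ideal (MvPolynomial (Fin n) C)}
    {f : MvPolynomial (Fin n) C} (hf : f ∈ I) (hfm : IsLexMonic f) (g : MvPolynomial (Fin n) C) :
    ∃ h ∈ I, IsLexMonic (g + h) := by
  rcases subsingleton_or_nontrivial C with _ | _
  · exact ⟨0, I.zero_mem, MonomialOrder.monic_of_subsingleton _⟩
  cases n with
  | zero =>
    have hf1 : f = 1 := by
      have h0 := MonomialOrder.lex.eq_C_of_degree_eq_zero (f := f) (Subsingleton.elim _ _)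
      rw [hfm.leadingCoeff_eq_one, C_1] at h0
      exact h0
    refine ⟨(1 - g) * f, I.mul_mem_left _ hf, ?_⟩
    rw [hf1, mul_one, add_sub_cancel]
    exact MonomialOrder.monic_one
  | succ n =>
    -- The extra factor `X 0` puts the product strictly above `g`.
    let e : Fin (n + 1) →₀ ℕ := MonomialOrder.lex.degree g + Finsupp.single 0 1
    refine ⟨monomial e 1 * f, I.mul_mem_left _ hf, ?_⟩
    rw [add_comm g]
    have hm : MonomialOrder.lex.Monic (monomial e (1 : C)) := MonomialOrder.monic_monomial_one
    refine (hm.mul hfm).add_of_lt ?_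
    have hreg : IsRegular (MonomialOrder.lex.leadingCoeff f) := by
      rw [hfm.leadingCoeff_eq_one]; exact isRegular_one
    rw [MonomialOrder.degree_mul_of_isRegular_right
      (fun h => one_ne_zero ((monomial_eq_zero).1 h)) hreg]
    classical
    rw [MonomialOrder.degree_monomial, if_neg one_ne_zero, map_add]
    refine lt_of_lt_of_le ?_ (MonomialOrder.lex.le_add_right e _)
    rw [map_add]
    refine lt_add_of_pos_right _ (MonomialOrder.lex.toSyn_lt_iff_ne_zero.2 ?_)
    rw [Ne, MonomialOrder.toSyn_eq_zero_iff]
    simp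

end LexMonic

/-! ### Prime avoidance and general position. -/

section GeneralPosition

variable {A : Type*} [CommRing A]

/-- Given `s` outside pairwise incomparable primes, some `a + t s` is outside all of them. -/
theorem exists_add_mul_notMem_of_primes (a s : A) (M : Finset (Ideal A))
    (hp : ∀ P ∈ M, P.IsPrime) (hs : ∀ P ∈ M, s ∉ P)
    (hinc : ∀ P ∈ M, ∀ Q ∈ M, P ≤ Q → P = Q) : ∃ t, ∀ P ∈ M, a + t * s ∉ P := by
  classical
  -- It suffices that `t` lies in the primes missing `a` and in none of those containing `a`.
  have h : ¬ (((∏ P ∈ M with a ∉ P, P : Ideal A) : Set A) ⊆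
      ⋃ Q ∈ ((M.filter (a ∈ ·) : Finset (Ideal A)) : Set (Ideal A)), (Q : Set A)) := by
    intro hsub
    obtain ⟨Q, hQ, hle⟩ := (Ideal.subset_union_prime (f := fun Q : Ideal A => Q) ⊤ ⊤
      fun i hi _ _ => hp i (Finset.mem_of_mem_filter i hi)).1 hsub
    rw [Finset.mem_filter] at hQ
    obtain ⟨P, hP, hPQ⟩ := ((hp Q hQ.1).prod_le (f := fun P : Ideal A => P)).1 hle
    rw [Finset.mem_filter] at hP
    exact hP.2 (hinc P hP.1 Q hQ.1 hPQ ▸ hQ.2)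
  obtain ⟨t, ht, ht'⟩ := Set.not_subset.1 h
  refine ⟨t, fun P hP hmem => ?_⟩
  by_cases haP : a ∈ P
  · have h1 : t * s ∈ P := by simpa using sub_mem hmem haP
    rcases (hp P hP).mem_or_mem h1 with h2 | h2
    · exact ht' (Set.mem_biUnion (by simpa using ⟨hP, haP⟩) h2)
    · exact hs P hP h2
  · have h1 : t ∈ P := by
      have := Ideal.prod_le_inf (s := M.filter (a ∉ ·)) (f := fun P : Ideal A => P) ht
      exact (Finset.inf_le (f := fun P : Ideal A => P)
        (Finset.mem_filter.2 ⟨hP, haP⟩)) this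
    exact haP (by simpa using sub_mem hmem (P.mul_mem_right s h1))

/-- General position: adding suitable multiples of `s` to the `a i`, every prime that contains all
of them but not `s` gets height at least their number. -/
theorem exists_add_mul_general_position [IsNoetherianRing A] {ι : Type*} (S : Finset ι)
    (a : ι → A) (s : A) :
    ∃ t : ι → A, ∀ P : Ideal A, P.IsPrime → (∀ i ∈ S, a i + t i * s ∈ P) → s ∉ P →
      (S.card : ℕ∞) ≤ P.height := by
  classical
  induction S using Finset.induction with
  | empty => exact ⟨0, fun P _ _ _ => by simp⟩
  | insert k S hk ih =>
    obtain ⟨t, ht⟩ := ih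
    let I : Ideal A := Ideal.span ((fun i => a i + t i * s) '' S)
    let M : Finset (Ideal A) := I.finite_minimalPrimes_of_isNoetherianRing.toFinset.filter (s ∉ ·)
    have hM : ∀ P, P ∈ M ↔ P ∈ I.minimalPrimes ∧ s ∉ P := fun P => by simp [M]
    -- A prime over `I` missing `s` lies over a member of `M`; avoiding `M` makes this strict and
    -- gains one in height.
    obtain ⟨c, hc⟩ := exists_add_mul_notMem_of_primes (a k) s M
      (fun P hP => ((hM P).1 hP).1.1.1) (fun P hP => ((hM P).1 hP).2)
      (fun P hP Q hQ hPQ => le_antisymm hPQ (((hM Q).1 hQ).1.2 ((hM P).1 hP).1.1 hPQ))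
    refine ⟨Function.update t k c, fun P hP hmem hs => ?_⟩
    have hmemS : ∀ i ∈ S, a i + t i * s ∈ P := fun i hi => by
      have := hmem i (Finset.mem_insert_of_mem hi)
      rwa [Function.update_of_ne (ne_of_mem_of_not_mem hi hk)] at this
    have hmemk : a k + c * s ∈ P := by simpa using hmem k (Finset.mem_insert_self k S)
    have hIP : I ≤ P := by
      rw [Ideal.span_le]
      rintro _ ⟨i, hi, rfl⟩
      exact hmemS i hi
    obtain ⟨Q, hQ, hQP⟩ := Ideal.exists_minimalPrimes_le hIP
    have hsQ : s ∉ Q := fun h => hs (hQP h)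
    have := hQ.1.1
    have hlt : Q < P := lt_of_le_of_ne hQP fun h => hc Q ((hM Q).2 ⟨hQ, hsQ⟩) (h ▸ hmemk)
    have h1 : (S.card : ℕ∞) ≤ Q.height := ht Q hQ.1.1
      (fun i hi => hQ.1.2 (Ideal.subset_span ⟨i, hi, rfl⟩)) hsQ
    rw [Finset.card_insert_of_notMem hk]
    push_cast
    exact (by gcongr : (S.card : ℕ∞) + 1 ≤ Q.height + 1).trans
      (Ideal.height_add_one_le_of_lt_of_isPrime hlt)

end GeneralPosition

namespace SplitOrthogonal

variable {R : Type*} [CommRing R] {r : ℕ}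

/-! ### Words of transvections and their action. -/

section Words

/-- `(i, j, ξ)` labels the long root transvection `T_{i,j}(ξ)`. -/
abbrev Label (r : ℕ) (R : Type*) : Type _ := EvenIdx r × EvenIdx r × R

/-- All labels of the word satisfy `i ≠ ±j`. -/
def IsWord (l : List (Label r R)) : Prop :=
  ∀ p ∈ l, p.1 ≠ p.2.1 ∧ p.1 ≠ negIdx p.2.1

/-- The product of the transvections of size `2r` labelled by a word. -/
def evenWord (l : List (Label r R)) : Matrix (EvenIdx r) (EvenIdx r) R :=
  (l.map fun p => evenT p.1 p.2.1 p.2.2).prod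

/-- The product of the long root transvections of size `2r + 1` labelled by a word. -/
def oddWord (l : List (Label r R)) : Matrix (OddIdx r) (OddIdx r) R :=
  (l.map fun p => oddLongT p.1 p.2.1 p.2.2).prod

theorem evenWord_mem_evenEOLe {l : List (Label r R)} {N : ℕ} (hl : IsWord l) (hN : l.length ≤ N) :
    evenWord l ∈ evenEOLe R r N := by
  refine ⟨l.map fun p => evenT p.1 p.2.1 p.2.2, by simpa using hN, fun t ht => ?_, rfl⟩
  obtain ⟨p, hp, rfl⟩ := List.mem_map.1 ht
  exact ⟨p.1, p.2.1, p.2.2, (hl p hp).1, (hl p hp).2, rfl⟩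

theorem oddWord_mem_oddEOLe {l : List (Label r R)} {N : ℕ} (hl : IsWord l) (hN : l.length ≤ N) :
    oddWord l ∈ oddEOLe R r N := by
  refine ⟨l.map fun p => oddLongT p.1 p.2.1 p.2.2, by simpa using hN, fun t ht => ?_, rfl⟩
  obtain ⟨p, hp, rfl⟩ := List.mem_map.1 ht
  exact Or.inl ⟨p.1, p.2.1, p.2.2, (hl p hp).1, (hl p hp).2, rfl⟩

theorem evenT_mulVec_apply (i j : EvenIdx r) (ξ : R) (x : EvenIdx r → R) (m : EvenIdx r) :
    (evenT i j ξ *ᵥ x) m =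
      x m + (if m = i then ξ * x j else 0) - (if m = negIdx j then ξ * x (negIdx i) else 0) := by
  simp [evenT, Matrix.sub_mulVec, Matrix.add_mulVec, Matrix.single_mulVec, Function.update_apply]

theorem oddLongT_mulVec_some (i j : EvenIdx r) (ξ : R) (x : OddIdx r → R) (m : EvenIdx r) :
    (oddLongT i j ξ *ᵥ x) (some m) = (evenT i j ξ *ᵥ fun m => x (some m)) m := by
  rw [evenT_mulVec_apply]
  simp [oddLongT, Matrix.sub_mulVec, Matrix.add_mulVec, Matrix.single_mulVec,
    Function.update_apply]

/-- This transfers the even case to the odd one: long root transvections neither read nor change the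
middle entry. -/
theorem oddWord_mulVec_some (l : List (Label r R)) (x : OddIdx r → R) (m : EvenIdx r) :
    (oddWord l *ᵥ x) (some m) = (evenWord l *ᵥ fun m => x (some m)) m := by
  induction l generalizing m with
  | nil => simp [oddWord, evenWord]
  | cons p l ih =>
    have h1 : oddWord (p :: l) = oddLongT p.1 p.2.1 p.2.2 * oddWord l := by simp [oddWord]
    have h2 : evenWord (p :: l) = evenT p.1 p.2.1 p.2.2 * evenWord l := by simp [evenWord]
    rw [h1, h2, ← Matrix.mulVec_mulVec, ← Matrix.mulVec_mulVec, oddLongT_mulVec_some]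
    simp_rw [ih]

end Words

/-- `y` is obtained from `x` by at most `N` transvections `T_{i,j}(ξ)` of size `2r`. -/
def Reach (N : ℕ) (x y : EvenIdx r → R) : Prop :=
  ∃ l : List (Label r R), l.length ≤ N ∧ IsWord l ∧ evenWord l *ᵥ x = y

theorem Reach.trans {M N : ℕ} {x y z : EvenIdx r → R} (hxy : Reach M x y) (hyz : Reach N y z) :
    Reach (N + M) x z := by
  obtain ⟨l, hl, hlw, rfl⟩ := hxy
  obtain ⟨l', hl', hlw', rfl⟩ := hyz
  refine ⟨l' ++ l, by simpa using add_le_add hl' hl, fun p hp => ?_, ?_⟩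
  · exact (List.mem_append.1 hp).elim (hlw' p) (hlw p)
  · simp [evenWord, Matrix.mulVec_mulVec]

/-- The effect of the transvections `T_{i,κ}(t i)` for `i` in an isotropic set `S` of indices. -/
theorem reach_batch (S : Finset (EvenIdx r)) (κ : EvenIdx r)
    (hS : ∀ i ∈ S, i ≠ κ ∧ i ≠ negIdx κ ∧ negIdx i ∉ S) (t x : EvenIdx r → R) :
    Reach S.card x fun m => if m ∈ S then x m + t m * x κ
      else if m = negIdx κ then x m - ∑ i ∈ S, t i * x (negIdx i) else x m := by
  classical
  induction S using Finset.induction with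
  | empty => exact ⟨[], by simp, by simp [IsWord], by ext m; simp [evenWord]⟩
  | insert k S hk ih =>
    obtain ⟨hkκ, hknκ, hkneg⟩ := hS k (Finset.mem_insert_self k S)
    have hS' : ∀ i ∈ S, i ≠ κ ∧ i ≠ negIdx κ ∧ negIdx i ∉ S := fun i hi =>
      have h := hS i (Finset.mem_insert_of_mem hi)
      ⟨h.1, h.2.1, fun h' => h.2.2 (Finset.mem_insert_of_mem h')⟩
    -- Since `S` avoids `±κ` and pairs `±i`, the entries at `κ` and `-i` stay fixed throughout, so
    -- the effects simply add up.
    have hκS : κ ∉ S := fun h => (hS' κ h).1 rfl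
    have hnκS : negIdx κ ∉ S := fun h => (hS' _ h).2.1 rfl
    have hκκ : κ ≠ negIdx κ := by cases κ <;> simp
    have hkS : negIdx k ∉ S := fun h => hkneg (Finset.mem_insert_of_mem h)
    have hkκ' : negIdx k ≠ negIdx κ := fun h => hkκ (Sum.swap_leftInverse.injective h)
    rw [Finset.card_insert_of_notMem hk, add_comm]
    refine (ih hS').trans ⟨[(k, κ, t k)], by simp, by simpa [IsWord] using ⟨hkκ, hknκ⟩, ?_⟩
    ext m
    rw [show evenWord [(k, κ, t k)] = evenT k κ (t k) by simp [evenWord], evenT_mulVec_apply]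
    simp only [if_neg hκS, if_neg hκκ, if_neg hkS, if_neg hkκ', Finset.mem_insert,
      Finset.sum_insert hk]
    rcases eq_or_ne m k with rfl | hmk
    · simp [hk, hknκ]
    · rcases eq_or_ne m (negIdx κ) with rfl | hmκ
      · simp only [hmk, hnκS, if_false, if_true, or_self]
        ring
      · simp [hmk, hmκ]

variable (k : Fin r) (t u v : Fin r → R)

theorem reach_add_neg_mul :
    Reach (r - 1) (Sum.elim u v)
      (Sum.elim (fun i => if i = k then u k - ∑ i ∈ Finset.univ.erase k, t i * v i
        else u i + t i * v k) v) := by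
  have h := reach_batch ((Finset.univ.erase k).map Function.Embedding.inl) (Sum.inr k)
    (by simp [negIdx]) (Sum.elim t t) (Sum.elim u v)
  rw [Finset.card_map, Finset.card_erase_of_mem (Finset.mem_univ k), Finset.card_univ,
    Fintype.card_fin] at h
  convert h using 1
  ext (m | m)
  · by_cases hm : m = k <;> simp [hm, negIdx]
  · simp [negIdx]

theorem reach_add_pos_mul :
    Reach (r - 1) (Sum.elim u v)
      (Sum.elim (fun i => if i = k then u k else u i + t i * u k)
        (fun i => if i = k then v k - ∑ i ∈ Finset.univ.erase k, t i * v i else v i)) := by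
  have h := reach_batch ((Finset.univ.erase k).map Function.Embedding.inl) (Sum.inl k)
    (by simp [negIdx]) (Sum.elim t t) (Sum.elim u v)
  rw [Finset.card_map, Finset.card_erase_of_mem (Finset.mem_univ k), Finset.card_univ,
    Fintype.card_fin] at h
  convert h using 1
  ext (m | m)
  · by_cases hm : m = k <;> simp [hm, negIdx]
  · by_cases hm : m = k <;> simp [hm, negIdx]

/-- The wanted change is the side effect at `-k` of the `T_{-i,k}(-t i)`; what happens to the other
`v i` is irrelevant. -/
theorem reach_neg_add_sum :
    ∃ y, Reach (r - 1) (Sum.elim u v) y ∧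
      y (Sum.inr k) = v k + ∑ i ∈ Finset.univ.erase k, t i * u i := by
  have h := reach_batch ((Finset.univ.erase k).map Function.Embedding.inr) (Sum.inl k)
    (by simp [negIdx]) (Sum.elim (-t) (-t)) (Sum.elim u v)
  rw [Finset.card_map, Finset.card_erase_of_mem (Finset.mem_univ k), Finset.card_univ,
    Fintype.card_fin] at h
  refine ⟨_, h, ?_⟩
  simp only [Finset.mem_map, Finset.sum_map]
  simp [negIdx, -Finset.sum_erase_eq_sub]

variable {k t u v}

theorem isUnimodular_of_forall_isPrime {ι : Type*} {x : ι → R}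
    (h : ∀ P : Ideal R, P.IsPrime → (∀ i, x i ∈ P) → False) : IsUnimodular x := by
  by_contra hne
  obtain ⟨P, hP, hle⟩ := Ideal.exists_le_maximal _ hne
  exact h P hP.isPrime fun i => hle (Ideal.subset_span ⟨i, rfl⟩)

theorem IsUnimodular.false_of_forall_mem {ι : Type*} {x : ι → R} (hx : IsUnimodular x)
    {P : Ideal R} (hP : P.IsPrime) (h : ∀ i, x i ∈ P) : False := by
  refine hP.ne_top (top_le_iff.1 (hx ▸ Ideal.span_le.2 ?_))
  rintro _ ⟨i, rfl⟩
  exact h i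

/-! ### Eliminating the primes of small height. -/

section GeneralPosition

variable [IsNoetherianRing R] {D : ℕ}

theorem exists_add_mul_mem_of_height_le (hr : D + 2 ≤ r) (k : Fin r) (a : Fin r → R) (s : R) :
    ∃ t : Fin r → R, ∀ P : Ideal R, P.IsPrime → P.height ≤ D →
      (∀ i, i ≠ k → a i + t i * s ∈ P) → s ∈ P := by
  obtain ⟨t, ht⟩ := exists_add_mul_general_position (Finset.univ.erase k) a s
  refine ⟨t, fun P hP hPD hmem => ?_⟩
  by_contra hs
  have h := (ht P hP (fun i hi => hmem i (Finset.ne_of_mem_erase hi)) hs).trans hPD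
  rw [Finset.card_erase_of_mem (Finset.mem_univ k), Finset.card_univ, Fintype.card_fin] at h
  have : r - 1 ≤ D := by exact_mod_cast h
  omega

/-- First reduction: every prime of small height over `u i`, `i ≠ k`, contains `v k`. -/
theorem exists_reach_mem_of_height_le (hr : D + 2 ≤ r) (k : Fin r) (u v : Fin r → R)
    (hx : IsUnimodular (Sum.elim u v)) :
    ∃ u' : Fin r → R, Reach (r - 1) (Sum.elim u v) (Sum.elim u' v) ∧
      IsUnimodular (Sum.elim u' v) ∧
      ∀ P : Ideal R, P.IsPrime → P.height ≤ D → (∀ i, i ≠ k → u' i ∈ P) → v k ∈ P := by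
  obtain ⟨t, ht⟩ := exists_add_mul_mem_of_height_le hr k u (v k)
  refine ⟨_, reach_add_neg_mul k t u v, isUnimodular_of_forall_isPrime fun P hP h => ?_,
    fun P hP hPD h => ht P hP hPD fun i hi => by simpa [hi] using h i hi⟩
  have hv : ∀ i, v i ∈ P := fun i => h (Sum.inr i)
  refine hx.false_of_forall_mem hP ?_
  rintro (i | i)
  · have hi := h (Sum.inl i)
    by_cases hik : i = k
    · subst hik
      simp only [Sum.elim_inl, if_true] at hi ⊢
      simpa using add_mem hi (sum_mem fun j (_ : j ∈ Finset.univ.erase i) =>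
        P.mul_mem_left (t j) (hv j))
    · simp only [Sum.elim_inl, if_neg hik] at hi ⊢
      simpa using sub_mem hi (P.mul_mem_left (t i) (hv k))
  · exact hv i

/-- Second reduction: no prime of small height contains `v k` and all `u i`, `i ≠ k`. -/
theorem exists_reach_notMem_of_height_le (hr : D + 2 ≤ r) (k : Fin r) (u v : Fin r → R)
    (hx : IsUnimodular (Sum.elim u v))
    (hk : ∀ P : Ideal R, P.IsPrime → P.height ≤ D → (∀ i, i ≠ k → u i ∈ P) → v k ∈ P) :
    ∃ u' v' : Fin r → R, Reach (r - 1) (Sum.elim u v) (Sum.elim u' v') ∧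
      ∀ P : Ideal R, P.IsPrime → P.height ≤ D → (∀ i, i ≠ k → u' i ∈ P) → v' k ∉ P := by
  have h1 : (1 : R) ∈ Ideal.span (Set.range (Sum.elim u v)) := hx ▸ Submodule.mem_top
  obtain ⟨c, hc⟩ := Ideal.mem_span_range_iff_exists_fun.1 h1
  rw [Fintype.sum_sum_type] at hc
  simp only [Sum.elim_inl, Sum.elim_inr] at hc
  set d : Fin r → R := fun i => c (Sum.inr i)
  -- With `s` a square, the multiplier of `u k` is `t i * u k - d i`, congruent to `-d i` modulo `u
  -- k`; this brings the relation `hc` into the new `v k`.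
  obtain ⟨t, ht⟩ := exists_add_mul_mem_of_height_le hr k (fun i => u i - d i * u k) (u k * u k)
  refine ⟨_, _, reach_add_pos_mul k (fun i => t i * u k - d i) u v, fun P hP hPD h hv => ?_⟩
  have huk : u k ∈ P := by
    refine or_self_iff.1 (hP.mem_or_mem (ht P hP hPD fun i hi => ?_))
    have := h i hi
    rw [if_neg hi] at this
    convert this using 1
    ring
  have hu : ∀ i, u i ∈ P := fun i => by
    by_cases hi : i = k
    · exact hi ▸ huk
    · have := h i hi
      rw [if_neg hi] at this
      simpa using sub_mem this (P.mul_mem_left (t i * u k - d i) huk)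
  have hvk : v k ∈ P := hk P hP hPD fun i _ => hu i
  refine hP.ne_top ((Ideal.eq_top_iff_one P).2 ?_)
  rw [if_pos rfl] at hv
  rw [← hc, ← Finset.add_sum_erase _ (fun i => c (Sum.inr i) * v i) (Finset.mem_univ k)]
  -- Modulo `P`, which contains `u k` and `v k`, the new `v k` is this sum.
  have hsum : ∑ i ∈ Finset.univ.erase k, d i * v i ∈ P := by
    have h2 : ∑ i ∈ Finset.univ.erase k, d i * v i =
        (v k - ∑ i ∈ Finset.univ.erase k, (t i * u k - d i) * v i) - v k
          + u k * ∑ i ∈ Finset.univ.erase k, t i * v i := by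
      rw [Finset.mul_sum]
      simp only [sub_mul, Finset.sum_sub_distrib]
      have : ∑ i ∈ Finset.univ.erase k, t i * u k * v i =
          ∑ i ∈ Finset.univ.erase k, u k * (t i * v i) :=
        Finset.sum_congr rfl fun i _ => by ring
      rw [this]
      ring
    rw [h2]
    exact add_mem (sub_mem hv hvk) (P.mul_mem_right _ huk)
  exact add_mem (sum_mem fun i _ => P.mul_mem_left _ (hu i))
    (add_mem (P.mul_mem_left _ hvk) hsum)

/-- After `3(r - 1)` transvections no prime of small height contains all `u i`, `i ≠ k`. -/
theorem exists_reach_not_forall_mem (hr : D + 2 ≤ r) (k : Fin r) (u v : Fin r → R)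
    (hx : IsUnimodular (Sum.elim u v)) :
    ∃ u' v' : Fin r → R, Reach (3 * (r - 1)) (Sum.elim u v) (Sum.elim u' v') ∧
      ∀ P : Ideal R, P.IsPrime → P.height ≤ D → ¬ ∀ i, i ≠ k → u' i ∈ P := by
  obtain ⟨u₁, h₁, hx₁, hk₁⟩ := exists_reach_mem_of_height_le hr k u v hx
  obtain ⟨u₂, v₂, h₂, hk₂⟩ := exists_reach_notMem_of_height_le hr k u₁ v hx₁ hk₁
  obtain ⟨t, ht⟩ := exists_add_mul_mem_of_height_le hr k u₂ (v₂ k)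
  have h := (h₁.trans h₂).trans (reach_add_neg_mul k t u₂ v₂)
  refine ⟨_, v₂, by convert h using 1; ring, fun P hP hPD hmem => ?_⟩
  have hmem' : ∀ i, i ≠ k → u₂ i + t i * v₂ k ∈ P := fun i hi => by
    simpa [hi] using hmem i hi
  have hv := ht P hP hPD hmem'
  exact hk₂ P hP hPD (fun i hi => by
    simpa using sub_mem (hmem' i hi) (P.mul_mem_left (t i) hv)) hv

end GeneralPosition

/-! ### Assembly of the bound `4 * (r - 1)`. -/

theorem exists_reach_isLexMonic {C : Type*} [CommRing C] [IsNoetherianRing C] {D n : ℕ}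
    (hD : ringKrullDim C ≤ (D : WithBot ℕ∞)) (hr : D + 2 ≤ r) (k : Fin r)
    (x : EvenIdx r → MvPolynomial (Fin n) C) (hx : IsUnimodular x) :
    ∃ y, Reach (4 * (r - 1)) x y ∧ IsLexMonic (y (Sum.inr k)) := by
  obtain ⟨u, v, rfl⟩ : ∃ u v, x = Sum.elim u v := ⟨_, _, (Sum.elim_comp_inl_inr x).symm⟩
  obtain ⟨u', v', h₁, hP⟩ := exists_reach_not_forall_mem hr k u v hx
  obtain ⟨f, hf, hfm⟩ := exists_isLexMonic_mem hD
    (Ideal.span (u' '' ((Finset.univ.erase k : Finset (Fin r)) : Set (Fin r))))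
    fun P hP' hle hPD => hP P hP' hPD fun i hi =>
      hle (Ideal.subset_span ⟨i, by simpa using hi, rfl⟩)
  obtain ⟨g, hg, hgm⟩ := exists_add_isLexMonic hf hfm (v' k)
  obtain ⟨c, rfl⟩ := (Submodule.mem_span_image_finset_iff_exists_fun' _).1 hg
  obtain ⟨y, hy, hyk⟩ := reach_neg_add_sum k c u' v'
  refine ⟨y, by convert h₁.trans hy using 1; ring, ?_⟩
  rw [hyk]
  simpa using hgm

/-- Deleting the middle entry of a column in `oddIUm` leaves a unimodular column. -/
theorem isUnimodular_comp_some {b : OddIdx r → R} (hb : b ∈ oddIUm R r) :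
    IsUnimodular fun i => b (some i) := by
  refine isUnimodular_of_forall_isPrime fun P hP h => hb.1.false_of_forall_mem hP ?_
  have hsq : b none ^ 2 ∈ P := by
    rw [eq_neg_of_add_eq_zero_left hb.2]
    exact neg_mem (sum_mem fun i _ => P.mul_mem_left _ (h _))
  rintro (_ | i)
  · exact P.mul_mem_left 2 (hP.mem_of_pow_mem 2 hsq)
  · exact h i

end SplitOrthogonal

open SplitOrthogonal in
theorem proposition1 {C : Type*} [CommRing C] [IsNoetherianRing C] (D n r : ℕ)
    (hD : ringKrullDim C ≤ (D : WithBot ℕ∞)) (hr : max 3 (D + 2) ≤ r) :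
    (∀ b ∈ evenIUm (MvPolynomial (Fin n) C) r,
      ∃ b' ∈ (fun g => g *ᵥ b) '' evenEOLe (MvPolynomial (Fin n) C) r (11 * r - 7),
        IsLexMonic (b' (minus 2 (by omega)))) ∧
    (∀ b ∈ oddIUm (MvPolynomial (Fin n) C) r,
      ∃ b' ∈ (fun g => g *ᵥ b) '' oddEOLe (MvPolynomial (Fin n) C) r (12 * r - 8),
        IsLexMonic (b' (some (minus 2 (by omega))))) := by
  have hr' : D + 2 ≤ r := (le_max_right _ _).trans hr
  have hr3 : 3 ≤ r := (le_max_left _ _).trans hr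
  refine ⟨fun b hb => ?_, fun b hb => ?_⟩
  -- The zero-based index 1 is `k = 2`, and `4 * (r - 1)` is below both stated bounds.
  · obtain ⟨_, ⟨l, hl, hlw, rfl⟩, hy⟩ :=
      exists_reach_isLexMonic hD hr' ⟨1, by omega⟩ b hb.1
    exact ⟨_, ⟨_, evenWord_mem_evenEOLe hlw (by omega), rfl⟩, hy⟩
  · obtain ⟨_, ⟨l, hl, hlw, rfl⟩, hy⟩ :=
      exists_reach_isLexMonic hD hr' ⟨1, by omega⟩ _ (isUnimodular_comp_some hb)
    refine ⟨_, ⟨_, oddWord_mem_oddEOLe hlw (by omega), rfl⟩, ?_⟩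
    rw [← oddWord_mulVec_some] at hy
    exact hy
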